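/- **Setting.** All logarithms are to base $2$. Inputs are $x\in\{1,2\}$, outputs are $a\in\{+1,-1\}$, and $|A|=2$ is the number of outputs. Vectors in $\mathbb R^2$ are compared componentwise. *Quantum behaviours.* An energy observable on a complex Hilbert space is an observable $O$ (possibly unbounded) with an orthonormal basis of eigenvectors, whose lowest eigenvalue is $0$ and non-degenerate and whose other eigenvalues are all $\ge 1$. $\mathcal Q\subset\mathbb R^4$ is the convex hull of the set of all $(\vec E,\vec\omega)=(E_1,E_2,\omega_1,\omega_2)$ for which there are a Hilbert space, density operators $\rho_1,\rho_2$, an observable $-1\le M\le 1$ and an energy observable $O$ on it with $\operatorname{Tr}[\rho_xM]=E_x$ and $\operatorname{Tr}[\rho_xO]\le\omega_x$ for $x=1,2$. For $\vec\omega_{\rm pk}\in\mathbb R^2$ let $\mathcal Q_{\vec\omega_{\rm pk}}=\{(\vec E,\vec\omega)\in\mathcal Q:\vec\omega\le\vec\omega_{\rm pk}\}$. *Trade-off functions.* Let $p$ be a probability distribution on $\{1,2\}$ with $p(1),p(2)>0$, and let $H(\vec E)=-\sum_{a,x}p(x)\frac{1+aE_x}2\log\frac{1+aE_x}2$. A triple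 $(\vec\alpha,\vec\beta,\vec\gamma)\in(\mathbb R^2)^3$ is a trade-off function with max-peak energies $\vec\omega_{\rm pk}$ if $\vec\gamma\le 0$ and $\alpha_1+\alpha_2+\vec\beta\cdot\vec E+\vec\gamma\cdot\vec\omega\le H(\vec E)$ for all $(\vec E,\vec\omega)\in\mathcal Q_{\vec\omega_{\rm pk}}$. Put $\xi(a,x)=\frac{1}{p(x)}(\alpha_x+a\beta_x)$, $\xi^+=\max_{a,x}\xi(a,x)$, $\xi^-=\min_{a,x}\xi(a,x)$, $\bar\gamma=\gamma_1+\gamma_2$. *The $n$-round model.* Let $n\ge1$, and let $A^n=(A_1,\dots,A_n)$, $X^n=(X_1,\dots,X_n)$ and $\Lambda$ (with values in an arbitrary measurable space) be random variables with joint law $\mu$; let $W_i=(A_1,\dots,A_{i-1},X_1,\dots,X_{i-1})$. Let $\vec\omega_{\rm pk}\le(1,1)$, $\vec\omega_{\rm avg}\in\mathbb R^2$ and $\epsilon_\omega\ge0$. Assume that there are measurable functions $\vec E_i,\vec\omega_i$ of $(W_i,\Lambda)$ such that, for all $i$ and almost surely, 1. $\mu(X_i=x\mid W_i,\Lambda)=p(x)$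 for all $x$; 2. $(\vec E_i(W_i,\Lambda),\vec\omega_i(W_i,\Lambda))\in\mathcal Q$ and $\mu(A_i=a\mid X_i=x,W_i,\Lambda)=\frac12\bigl(1+aE_{i,x}(W_i,\Lambda)\bigr)$; 3. $\vec\omega_i(W_i,\Lambda)\le\vec\omega_{\rm pk}$; and that 4. $\Pr\bigl(\frac1n\sum_{i=1}^n\vec\omega_i(W_i,\Lambda)\le\vec\omega_{\rm avg}\bigr)\ge1-\epsilon_\omega$. **Theorem.** Let $\epsilon_t>0$, let $\mu$ be as above, and let $(\vec\alpha,\vec\beta,\vec\gamma)$ be a trade-off function with max-peak energies $\vec\omega_{\rm pk}$. Let $$t=\sqrt{2V}\sqrt{\frac{\log(1/\epsilon_t)}n}+\frac{\xi^+}3\,\frac{\log(1/\epsilon_t)}n,$$ $$V=\max\{(\xi^++\bar\gamma)^2,(\xi^-+\bar\gamma)^2\}+2\max\{-\log|A|\,(\bar\gamma+\xi^-),0\}+\frac{4|A|}{e^2}(\log_2e)^2,$$ and assume that $t\ge0$ (which is automatic if $\xi^+\ge0$ and $\epsilon_t\le1$). Then, with probability at least $1-\epsilon_\omega-\epsilon_t$,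 $$-\frac1n\log\mu(A^n\mid X^n,\Lambda)\;\ge\;\frac1n\sum_{i=1}^n\xi(A_i,X_i)+\vec\gamma\cdot\vec\omega_{\rm avg}-t .$$ -/

import Mathlib

open MeasureTheory ProbabilityTheory

namespace SemiDI

/-! ### Quantum behaviours

Inputs `x ∈ {1,2}` are modelled by `Fin 2`; outputs `a ∈ {+1,-1}` by `Bool` through `sgn`. -/

section Quantum

variable {H : Type} [NormedAddCommGroup H] [InnerProductSpace ℂ H] [CompleteSpace H]

/-- `Tr T = c`: in every orthonormal (Hilbert) basis the diagonal of `T` sums unconditionally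
to `c`. -/
def HasTrace (T : H →L[ℂ] H) (c : ℂ) : Prop :=
  ∀ (ι : Type) (b : HilbertBasis ι ℂ H), HasSum (fun i => inner ℂ (b i) (T (b i))) c

/-- A quantum state: a positive operator of trace one. -/
def IsState (ρ : H →L[ℂ] H) : Prop :=
  ρ.IsPositive ∧ HasTrace ρ 1

/-- An energy observable `O = ∑ i, eig i |b i⟩⟨b i|` (possibly unbounded), given by an orthonormal
basis of eigenvectors `b` and the corresponding eigenvalues: the lowest eigenvalue is `0`, it is
non-degenerate (its only eigenvector is `b vac`), and all other eigenvalues are at least `1`. -/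
structure EnergyObservable (H : Type) [NormedAddCommGroup H] [InnerProductSpace ℂ H]
    [CompleteSpace H] where
  /-- index set of the eigenbasis -/
  ι : Type
  /-- orthonormal basis of eigenvectors -/
  basis : HilbertBasis ι ℂ H
  /-- eigenvalues -/
  eig : ι → ℝ
  /-- index of the vacuum -/
  vac : ι
  eig_vac : eig vac = 0
  one_le_eig : ∀ i, i ≠ vac → 1 ≤ eig i

/-- `Tr[ρ O] ≤ w`: the mean energy `∑ i, eig i ⟨b i|ρ|b i⟩` is finite and at most `w`. -/
def EnergyObservable.MeanLE (O : EnergyObservable H) (ρ : H →L[ℂ] H) (w : ℝ) : Prop :=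
  ∃ s : ℝ, HasSum (fun i => O.eig i * (inner ℂ (O.basis i) (ρ (O.basis i))).re) s ∧ s ≤ w

end Quantum

/-- A behaviour `(E, ω)`: correlations `E = (E₁, E₂)` and energy bounds `ω = (ω₁, ω₂)`. -/
abbrev Behaviour : Type := (Fin 2 → ℝ) × (Fin 2 → ℝ)

/-- `(E, ω)` is realized, without shared randomness, by two states `ρ₁, ρ₂`, an observable
`-1 ≤ M ≤ 1` and an energy observable `O` on some complex Hilbert space:
`Tr[ρ_x M] = E_x` and `Tr[ρ_x O] ≤ ω_x`. -/
def IsRealizable (q : Behaviour) : Prop :=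
  ∃ (H : Type) (_ : NormedAddCommGroup H) (_ : InnerProductSpace ℂ H) (_ : CompleteSpace H)
    (ρ : Fin 2 → H →L[ℂ] H) (M : H →L[ℂ] H) (O : EnergyObservable H),
    (∀ x, IsState (ρ x)) ∧ IsSelfAdjoint M ∧ -1 ≤ M ∧ M ≤ 1 ∧
    (∀ x, HasTrace (ρ x * M) ((q.1 x : ℝ) : ℂ)) ∧
    (∀ x, O.MeanLE (ρ x) (q.2 x))

/-- The quantum set `𝒬`: convex combinations of realizable behaviours. -/
def quantumSet : Set Behaviour := convexHull ℝ {q | IsRealizable q}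

/-- The set `𝒬_pk` of quantum behaviours with energies bounded by `ωpk`. -/
def quantumSetPeak (ωpk : Fin 2 → ℝ) : Set Behaviour := {q | q ∈ quantumSet ∧ q.2 ≤ ωpk}

/-! ### Entropy, trade-off functions and the error term (all logarithms in base two) -/

noncomputable section

/-- The value `±1` of an output. -/
def sgn (a : Bool) : ℝ := if a then 1 else -1

/-- `p(a|x) = (1 + a E_x) / 2`. -/
def outProb (E : Fin 2 → ℝ) (a : Bool) (x : Fin 2) : ℝ := (1 + sgn a * E x) / 2

/-- The conditional Shannon entropy `H(E)`, for the input distribution `p`. -/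
def entropy (p : Fin 2 → ℝ) (E : Fin 2 → ℝ) : ℝ :=
  -∑ a : Bool, ∑ x : Fin 2, p x * outProb E a x * Real.logb 2 (outProb E a x)

/-- `(α, β, γ)` is a trade-off function with max-peak energies `ωpk`. -/
def IsTradeoffFunction (p ωpk α β γ : Fin 2 → ℝ) : Prop :=
  γ ≤ 0 ∧ ∀ q ∈ quantumSetPeak ωpk,
    ∑ x, α x + ∑ x, β x * q.1 x + ∑ x, γ x * q.2 x ≤ entropy p q.1

/-- The estimator `ξ(a,x) = (α_x + a β_x) / p(x)`. -/
def xi (p α β : Fin 2 → ℝ) (a : Bool) (x : Fin 2) : ℝ := (α x + sgn a * β x) / p x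

/-- `ξ⁺ = max_{a,x} ξ(a,x)`. -/
def xiMax (p α β : Fin 2 → ℝ) : ℝ := ⨆ q : Bool × Fin 2, xi p α β q.1 q.2

/-- `ξ⁻ = min_{a,x} ξ(a,x)`. -/
def xiMin (p α β : Fin 2 → ℝ) : ℝ := ⨅ q : Bool × Fin 2, xi p α β q.1 q.2

/-- The variance bound `V`; the number `|A|` of outputs is `Fintype.card Bool`. -/
def varBound (p α β γ : Fin 2 → ℝ) : ℝ :=
  max ((xiMax p α β + ∑ x, γ x) ^ 2) ((xiMin p α β + ∑ x, γ x) ^ 2)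
    + 2 * max (-(Real.logb 2 (Fintype.card Bool) * (∑ x, γ x + xiMin p α β))) 0
    + 4 * (Fintype.card Bool : ℝ) / Real.exp 1 ^ 2 * Real.logb 2 (Real.exp 1) ^ 2

/-- The error term `t`. -/
def errorTerm (n : ℕ) (p α β γ : Fin 2 → ℝ) (εt : ℝ) : ℝ :=
  √(2 * varBound p α β γ) * √(Real.logb 2 (1 / εt) / n)
    + xiMax p α β / 3 * (Real.logb 2 (1 / εt) / n)

/-! ### The `n`-round model -/

/-- The conditional probability `μ(Y | Z)` as a random variable: the regular conditional
probability, given the actual value of `Z`, that `Y = y`. -/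
def condProb {Ω S T : Type*} [MeasurableSpace Ω] [MeasurableSpace S] [StandardBorelSpace S]
    [Nonempty S] [MeasurableSpace T] (μ : Measure Ω) [IsFiniteMeasure μ]
    (Y : Ω → S) (Z : Ω → T) (y : S) (ω : Ω) : ℝ :=
  (condDistrib Y Z μ (Z ω)).real {y}

/-- The past `W_i = (A^{i-1}, X^{i-1})`: outputs and inputs of all rounds before round `i`. -/
def past {Ω : Type*} {n : ℕ} (A : Fin n → Ω → Bool) (X : Fin n → Ω → Fin 2) (i : Fin n) (ω : Ω) :
    Fin i.val → Bool × Fin 2 :=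
  fun j => (A (Fin.castLE i.isLt.le j) ω, X (Fin.castLE i.isLt.le j) ω)

/-- The assumptions on the joint distribution of the outputs `A`, the inputs `X` and the
adversary's information `Λ`, with `E i w l` and `en i w l` the correlations and the energies of the
device at round `i` when the past is `w` and the adversary's information is `l`. -/
structure NRoundModel {Ω L : Type*} [MeasurableSpace Ω] [MeasurableSpace L]
    (μ : Measure Ω) [IsProbabilityMeasure μ] {n : ℕ}
    (A : Fin n → Ω → Bool) (X : Fin n → Ω → Fin 2) (Λ : Ω → L)
    (E en : (i : Fin n) → (Fin i.val → Bool × Fin 2) → L → Fin 2 → ℝ)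
    (p ωpk ωavg : Fin 2 → ℝ) (εω : ℝ) : Prop where
  measurable_A : ∀ i, Measurable (A i)
  measurable_X : ∀ i, Measurable (X i)
  measurable_Λ : Measurable Λ
  measurable_E : ∀ i w, Measurable (E i w)
  measurable_en : ∀ i w, Measurable (en i w)
  /-- `X_i` has law `p` conditionally on the past and on `Λ`. -/
  input : ∀ i x, ∀ᵐ ω ∂μ, condProb μ (X i) (fun ω => (past A X i ω, Λ ω)) x ω = p x
  /-- The behaviour of the device at each round is quantum. -/
  quantum : ∀ i, ∀ᵐ ω ∂μ, (E i (past A X i ω) (Λ ω), en i (past A X i ω) (Λ ω)) ∈ quantumSet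
  /-- The output `A_i` is produced by that behaviour on input `X_i`. -/
  output : ∀ i a, ∀ᵐ ω ∂μ,
    condProb μ (A i) (fun ω => (X i ω, past A X i ω, Λ ω)) a ω
      = outProb (E i (past A X i ω) (Λ ω)) a (X i ω)
  /-- Max-peak assumption. -/
  peak : ∀ i, ∀ᵐ ω ∂μ, en i (past A X i ω) (Λ ω) ≤ ωpk
  /-- Max-average assumption. -/
  average : 1 - εω ≤
    μ.real {ω | ∀ x, (1 / (n : ℝ)) * ∑ i, en i (past A X i ω) (Λ ω) x ≤ ωavg x}

end

end SemiDI

open scoped ENNReal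

namespace SemiDI

/-! ### One-variable inequalities -/

section Analysis

/-! Call ξ(A_i,X_i) + γ·ω_i + log p(A_i|X_i) the score of round i (`roundScore`). The trade-off
inequality says that its mean given the past and Λ is at most zero. Given all inputs and Λ, the
probability of the outputs is the product of the one-round probabilities
(`NRoundModel.ae_condProb_eq`). As γ ≤ 0, the claim thus holds wherever the average-energy bound
holds and the total score is at most n·t.

The tail of the total score is bounded by Chernoff's method: each factor exp(c·score − ψ) has
conditional mean at most one, hence so does the product (`lintegral_prod_le_one`), and Markov's
inequality applies. The delicate point is the linear term ξ⁺/3 of t. Centring a score of mean −d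
raises its upper bound from ξ⁺ to ξ⁺ + d, which plain Bernstein would put into t.
`sum_mul_exp_le_of_mean` shows that the negative drift pays for this if d ≤ √V and r/3 + r²/6 ≤ 1,
where r = √(2 log(1/ε_t)/n).

The first condition comes from `neg_xiMin_le_sqrt_varBound`. For the second, t ≥ ξ⁺ is a trivial
case since scores never exceed ξ⁺; otherwise ξ⁺ ≤ 2√V turns t < ξ⁺ into r/2 + r²/6 < 1. The bound ξ⁺
≤ 2√V rests on ξ⁻ ≤ 0 (`xiMin_nonpos`), obtained by testing the trade-off inequality on the vacuum,
which allows a deterministic output at zero energy. -/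

/-- Bernstein's inequality for the exponential, with denominators cleared. -/
lemma bernstein_exp_aux (z : ℝ) : (1 - z / 3) * (Real.exp z - 1 - z) ≤ z ^ 2 / 2 := by
  let f : ℝ → ℝ := fun z => z ^ 2 / 2 - (1 - z / 3) * (Real.exp z - 1 - z)
  let g : ℝ → ℝ := fun z => z + (Real.exp z - 1 - z) / 3 - (1 - z / 3) * (Real.exp z - 1)
  have hf : ∀ z, HasDerivAt f (g z) z := by
    intro z
    have h1 : HasDerivAt (fun z : ℝ => Real.exp z - 1 - z) (Real.exp z - 1) z :=
      ((Real.hasDerivAt_exp z).sub_const 1).sub (hasDerivAt_id z)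
    have h2 : HasDerivAt (fun z : ℝ => 1 - z / 3) (-(1 / 3)) z :=
      ((hasDerivAt_id z).div_const 3).const_sub 1
    have h3 : HasDerivAt (fun z : ℝ => z ^ 2 / 2) z z := 
      ((hasDerivAt_pow 2 z).div_const 2).congr_deriv (by norm_num)
    exact (h3.sub (h2.mul h1)).congr_deriv (by simp only [g]; ring)
  have hg : ∀ z, HasDerivAt g ((1 - Real.exp z + z * Real.exp z) / 3) z := by
    intro z
    have h0 : HasDerivAt (fun z : ℝ => Real.exp z - 1) (Real.exp z) z :=
      (Real.hasDerivAt_exp z).sub_const 1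
    have h1 : HasDerivAt (fun z : ℝ => Real.exp z - 1 - z) (Real.exp z - 1) z :=
      h0.sub (hasDerivAt_id z)
    have h2 : HasDerivAt (fun z : ℝ => 1 - z / 3) (-(1 / 3)) z :=
      ((hasDerivAt_id z).div_const 3).const_sub 1
    exact (((hasDerivAt_id z).add (h1.div_const 3)).sub (h2.mul h0)).congr_deriv (by ring)
  -- The second derivative of `f` is nonnegative since exp(−z) ≥ 1 − z. So `g` increases through its
  -- zero at 0, where `f` has its minimum 0.
  have hgm : Monotone g := by
    refine monotone_of_deriv_nonneg (fun z => (hg z).differentiableAt) fun z => ?_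
    rw [(hg z).deriv]
    have h1 := Real.add_one_le_exp (-z)
    have h2 : Real.exp (-z) * Real.exp z = 1 := by rw [← Real.exp_add]; simp
    nlinarith [Real.exp_pos z]
  have hg0 : g 0 = 0 := by simp [g]
  have hf0 : f 0 = 0 := by simp [f]
  have hcont : Continuous f := continuous_iff_continuousAt.2 fun z => (hf z).continuousAt
  suffices 0 ≤ f z by
    simp only [f] at this
    linarith
  rcases le_total 0 z with hz | hz
  · have : MonotoneOn f (Set.Ici 0) := by
      refine monotoneOn_of_deriv_nonneg (convex_Ici 0) hcont.continuousOn
        (fun x _ => (hf x).differentiableAt.differentiableWithinAt) fun x hx => ?_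
      rw [interior_Ici] at hx
      rw [(hf x).deriv, ← hg0]
      exact hgm (le_of_lt hx)
    rw [← hf0]
    exact this (Set.mem_Ici.2 le_rfl) hz hz
  · have : AntitoneOn f (Set.Iic 0) := by
      refine antitoneOn_of_deriv_nonpos (convex_Iic 0) hcont.continuousOn
        (fun x _ => (hf x).differentiableAt.differentiableWithinAt) fun x hx => ?_
      rw [interior_Iic] at hx
      rw [(hf x).deriv, ← hg0]
      exact hgm (le_of_lt hx)
    rw [← hf0]
    exact this hz (Set.mem_Iic.2 le_rfl) hz

/-- Only an upper bound on z is required. This matters because scores contain log p, which is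
unbounded below. -/
lemma exp_le_of_le {z x : ℝ} (hzx : z ≤ x) (hx : x < 3) :
    Real.exp z ≤ 1 + z + z ^ 2 / (2 * (1 - x / 3)) := by
  have h1 : 0 < 1 - x / 3 := by linarith
  have h2 : 0 < 1 - z / 3 := by linarith
  have h3 : Real.exp z - 1 - z ≤ z ^ 2 / (2 * (1 - z / 3)) := by
    rw [le_div_iff₀ (by positivity)]
    linarith [bernstein_exp_aux z]
  have h4 : z ^ 2 / (2 * (1 - z / 3)) ≤ z ^ 2 / (2 * (1 - x / 3)) := by
    gcongr
  linarith

/-- Bernstein's bound on the moment generating function of a centred finite random variable with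
law `P`, bounded above by `B`, of variance at most `V`. -/
lemma sum_mul_exp_le {S : Type*} [Fintype S] (P Z : S → ℝ) (hP : ∀ s, 0 ≤ P s)
    (hP1 : ∑ s, P s = 1) (hZ : ∑ s, P s * Z s = 0) {V B c : ℝ} (hV : ∑ s, P s * Z s ^ 2 ≤ V)
    (hB : ∀ s, Z s ≤ B) (hc : 0 ≤ c) (hcB : c * B < 3) :
    ∑ s, P s * Real.exp (c * Z s) ≤ Real.exp (c ^ 2 * V / (2 * (1 - c * B / 3))) := by
  have h0 : 0 < 2 * (1 - c * B / 3) := by linarith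
  calc ∑ s, P s * Real.exp (c * Z s)
      ≤ ∑ s, P s * (1 + c * Z s + (c * Z s) ^ 2 / (2 * (1 - c * B / 3))) := by
        gcongr with s
        · exact hP s
        · exact exp_le_of_le (mul_le_mul_of_nonneg_left (hB s) hc) hcB
    _ = ∑ s, P s + c * ∑ s, P s * Z s
          + c ^ 2 * (∑ s, P s * Z s ^ 2) / (2 * (1 - c * B / 3)) := by
        rw [Finset.mul_sum, Finset.mul_sum, Finset.sum_div, ← Finset.sum_add_distrib,
          ← Finset.sum_add_distrib]
        refine Finset.sum_congr rfl fun s _ => ?_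
        ring
    _ ≤ c ^ 2 * V / (2 * (1 - c * B / 3)) + 1 := by
        rw [hP1, hZ]
        have : c ^ 2 * (∑ s, P s * Z s ^ 2) / (2 * (1 - c * B / 3))
          ≤ c ^ 2 * V / (2 * (1 - c * B / 3)) := by gcongr
        linarith
    _ ≤ _ := Real.add_one_le_exp _

/-- The same bound for a random variable `Y ≤ b` with mean `-d ∈ [-v, 0]` and variance at most
`v ^ 2`, at the parameter that is optimal for `d = 0`. -/
lemma sum_mul_exp_le_of_mean {S : Type*} [Fintype S] (P Y : S → ℝ) (hP : ∀ s, 0 ≤ P s)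
    (hP1 : ∑ s, P s = 1) {b d v r : ℝ} (hd : ∑ s, P s * Y s = -d) (hd0 : 0 ≤ d) (hdv : d ≤ v)
    (hv : 0 < v) (hV : ∑ s, P s * (Y s + d) ^ 2 ≤ v ^ 2) (hb : 0 < b) (hY : ∀ s, Y s ≤ b)
    (hr : 0 ≤ r) (hr1 : r / 3 + r ^ 2 / 6 ≤ 1) :
    ∑ s, P s * Real.exp (r / (v + b * r / 3) * Y s)
      ≤ Real.exp (r ^ 2 * v / (2 * (v + b * r / 3))) := by
  set N := v + b * r / 3 with hN
  have hN0 : 0 < N := by positivity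
  set c := r / N with hc
  have hc0 : 0 ≤ c := by positivity
  have hrd : r * d ≤ r * v := by gcongr
  rcases hr.eq_or_lt with rfl | hr0
  · simp [hc, hP1]
  -- Bernstein's bound is applied to Y + d ≤ b + d; the quantity w/N is then 1 − c(b+d)/3. It is
  -- positive since d ≤ v and r < 3.
  set w := v - r * d / 3 with hw_def
  have hw : 0 < w := by nlinarith
  have hw' : 1 - c * (b + d) / 3 = (w) / N := by
    rw [hc, hN, hw_def]; field_simp; ring
  have hZ := sum_mul_exp_le P (fun s => Y s + d) hP hP1 (V := v ^ 2) (B := b + d) (c := c)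
    (by simp_rw [mul_add]; rw [Finset.sum_add_distrib, ← Finset.sum_mul, hd, hP1]; ring) hV
    (fun s => by linarith [hY s]) hc0 (by
      have : 0 < 1 - c * (b + d) / 3 := by rw [hw']; positivity
      linarith)
  have h1 : ∑ s, P s * Real.exp (c * Y s)
      = Real.exp (-(c * d)) * ∑ s, P s * Real.exp (c * (Y s + d)) := by
    rw [Finset.mul_sum]
    refine Finset.sum_congr rfl fun s _ => ?_
    rw [mul_left_comm, ← Real.exp_add]
    congr 2
    ring
  rw [h1]
  refine (mul_le_mul_of_nonneg_left hZ (Real.exp_pos _).le).trans ?_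
  rw [← Real.exp_add, Real.exp_le_exp, hw']
  have h2 : c ^ 2 * v ^ 2 / (2 * ((w) / N))
      = r ^ 2 * v ^ 2 / (2 * N * (w)) := by
    rw [hc]; field_simp
  -- The claimed exponent minus the one obtained. It is d times a factor that is nonnegative because
  -- w − r²v/6 ≥ v(1 − r/3 − r²/6): this is where `hr1` and `hdv` enter.
  have h3 : r ^ 2 * v / (2 * N) + c * d - r ^ 2 * v ^ 2 / (2 * N * (w))
      = r * d * (w - r ^ 2 * v / 6) / (N * (w)) := by
    have hd' : d = 3 * (v - w) / r := by rw [hw_def]; field_simp; ring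
    have hw0 : w ≠ 0 := hw.ne'
    clear_value w
    rw [hc, hd']; field_simp; ring
  have h4 : 0 ≤ r * d * (w - r ^ 2 * v / 6) / (N * (w)) := by
    have : 0 ≤ w - r ^ 2 * v / 6 := by nlinarith
    positivity
  rw [h2]
  linarith

/-- The exponent of the Chernoff bound at the parameter of `sum_mul_exp_le_of_mean`. -/
lemma chernoff_exponent {b v r : ℝ} (hb : 0 < b) (hv : 0 < v) (hr : 0 ≤ r) :
    r / (v + b * r / 3) * (v * r + b / 3 * (r ^ 2 / 2)) - r ^ 2 * v / (2 * (v + b * r / 3))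
      = r ^ 2 / 2 := by
  have hN0 : 0 < v + b * r / 3 := by positivity
  field_simp
  ring

/-- For q = exp(−2y) the left side is 4(y·exp(−y))², and y·exp(−y) is largest at y = 1. -/
lemma mul_log_sq_le {q : ℝ} (hq : 0 ≤ q) (hq1 : q ≤ 1) :
    q * Real.log q ^ 2 ≤ 4 / Real.exp 1 ^ 2 := by
  rcases hq.eq_or_lt with rfl | hq0
  · simp; positivity
  have hl : Real.log q ≤ 0 := Real.log_nonpos hq hq1
  set y := -Real.log q / 2 with hy
  have hy0 : 0 ≤ y := by rw [hy]; linarith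
  have hq2 : q = Real.exp (-y) ^ 2 := by
    rw [← Real.exp_nat_mul, hy]
    have : ((2 : ℕ) : ℝ) * -(-Real.log q / 2) = Real.log q := by push_cast; ring
    rw [this, Real.exp_log hq0]
  have h1 : y ≤ Real.exp y / Real.exp 1 := by
    rw [← Real.exp_sub]
    linarith [Real.add_one_le_exp (y - 1)]
  have h2 : Real.exp (-y) * y ≤ 1 / Real.exp 1 := by
    calc Real.exp (-y) * y ≤ Real.exp (-y) * (Real.exp y / Real.exp 1) := by gcongr
      _ = _ := by rw [← mul_div_assoc, ← Real.exp_add]; simp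
  have h3 : q * Real.log q ^ 2 = 4 * (Real.exp (-y) * y) ^ 2 := by
    have : Real.log q = -2 * y := by rw [hy]; ring
    rw [this]
    nth_rewrite 1 [hq2]
    ring
  rw [h3]
  calc 4 * (Real.exp (-y) * y) ^ 2 ≤ 4 * (1 / Real.exp 1) ^ 2 := by gcongr
    _ = _ := by ring

end Analysis

/-! ### Energies of quantum behaviours and the vacuum -/

/-- Eigenvalues and diagonal entries of a state are nonnegative. With γ ≤ 0 this makes the energy
term of a score nonpositive, so that ξ⁺ bounds the score. -/
lemma IsRealizable.energy_nonneg {q : Behaviour} (hq : IsRealizable q) : 0 ≤ q.2 := by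
  obtain ⟨H, _, _, _, ρ, M, O, hρ, -, -, -, -, hO⟩ := hq
  intro x
  obtain ⟨s, hs, hsw⟩ := hO x
  refine le_trans (hs.nonneg fun i => mul_nonneg ?_ ?_) hsw
  · by_cases hi : i = O.vac
    · rw [hi, O.eig_vac]
    · linarith [O.one_le_eig _ hi]
  · exact (Complex.nonneg_iff.1 ((hρ x).1.inner_nonneg_right (O.basis i))).1

lemma energy_nonneg_of_mem_quantumSet {q : Behaviour} (hq : q ∈ quantumSet) : 0 ≤ q.2 := by
  refine convexHull_min (t := {q : Behaviour | 0 ≤ q.2}) (fun q h => h.energy_nonneg) ?_ hq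
  exact (convex_Ici (0 : Fin 2 → ℝ)).linear_preimage (LinearMap.snd ℝ _ _)

/-- Parseval's identity for the vector 1 gives the trace in every basis at once, as `HasTrace`
demands. -/
lemma hasTrace_smul_one (c : ℂ) : HasTrace (c • (1 : ℂ →L[ℂ] ℂ)) c := by
  intro ι b
  have h := (b.hasSum_inner_mul_inner (1 : ℂ) (1 : ℂ)).mul_left c
  simp only [RCLike.inner_apply, map_one, mul_one, one_mul] at h
  have he : (fun i => inner ℂ (b i) ((c • (1 : ℂ →L[ℂ] ℂ)) (b i)))
      = fun i => c * (b i * starRingEnd ℂ (b i)) := by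
    funext i
    simp only [RCLike.inner_apply, smul_apply, one_apply_eq_self, smul_eq_mul]
    ring
  rw [he]
  exact h

/-- The one-dimensional energy observable, whose only level is the vacuum. -/
noncomputable def vacuumObservable : EnergyObservable ℂ where
  ι := Unit
  basis := (OrthonormalBasis.singleton Unit ℂ).toHilbertBasis
  eig := 0
  vac := ()
  eig_vac := rfl
  one_le_eig _ hi := (hi rfl).elim

/-- Sending the vacuum, a device produces any deterministic output at zero energy. -/
lemma isRealizable_vacuum (a : Bool) : IsRealizable (fun _ => sgn a, 0) := by
  refine ⟨ℂ, inferInstance, inferInstance, inferInstance, fun _ => 1, ((sgn a : ℝ) : ℂ) • 1,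
    vacuumObservable, fun _ => ⟨ContinuousLinearMap.isPositive_one, ?_⟩, ?_, ?_, ?_, fun _ => ?_,
    fun _ => ⟨0, ?_, le_rfl⟩⟩
  · simpa using hasTrace_smul_one 1
  · cases a
    · simpa [sgn] using (IsSelfAdjoint.one (ℂ →L[ℂ] ℂ)).neg
    · simp [sgn]
  · cases a
    · simp [sgn]
    · simp only [sgn, if_true, Complex.ofReal_one, one_smul]
      rw [ContinuousLinearMap.le_def]
      simpa using ContinuousLinearMap.isPositive_one.add ContinuousLinearMap.isPositive_one
  · cases a
    · simp only [sgn]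
      rw [ContinuousLinearMap.le_def]
      simpa using ContinuousLinearMap.isPositive_one.add ContinuousLinearMap.isPositive_one
    · simp [sgn]
  · rw [one_mul]
    exact hasTrace_smul_one ((sgn a : ℝ) : ℂ)
  · simp [vacuumObservable]

lemma vacuum_mem_quantumSetPeak {ωpk : Fin 2 → ℝ} (h : 0 ≤ ωpk) (a : Bool) :
    ((fun _ => sgn a, 0) : Behaviour) ∈ quantumSetPeak ωpk :=
  ⟨subset_convexHull ℝ _ (isRealizable_vacuum a), h⟩

/-! ### Disintegration along the rounds -/

section Disintegration

variable {Ω L S T : Type*} [MeasurableSpace Ω] [MeasurableSpace L] [MeasurableSpace S]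
  [MeasurableSpace T]

/-- The tower property. Values in [0,∞] dispense with integrability here and in all later averaging
steps. -/
lemma lintegral_comp_eq_condProb [StandardBorelSpace S] [Nonempty S] [Fintype S]
    [MeasurableSingletonClass S] (μ : Measure Ω) [IsFiniteMeasure μ] {Y : Ω → S} {Z : Ω → T}
    (hY : Measurable Y) (hZ : Measurable Z) (g : S → T → ℝ≥0∞) (hg : ∀ y, Measurable (g y)) :
    ∫⁻ ω, g (Y ω) (Z ω) ∂μ
      = ∫⁻ ω, ∑ y, ENNReal.ofReal (condProb μ Y Z y ω) * g y (Z ω) ∂μ := by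
  have hf : Measurable fun q : T × S => g q.2 q.1 := measurable_from_prod_countable_left hg
  have hk : Measurable fun z => ∑ y, (condDistrib Y Z μ z) {y} * g y z :=
    Finset.measurable_sum _ fun y _ =>
      ((condDistrib Y Z μ).measurable_coe (measurableSet_singleton y)).mul (hg y)
  calc ∫⁻ ω, g (Y ω) (Z ω) ∂μ
      = ∫⁻ q, g q.2 q.1 ∂(μ.map fun ω => (Z ω, Y ω)) :=
        (lintegral_map hf (hZ.prodMk hY)).symm
    _ = ∫⁻ z, ∑ y, (condDistrib Y Z μ z) {y} * g y z ∂(μ.map Z) := by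
        rw [← compProd_map_condDistrib hY.aemeasurable, Measure.lintegral_compProd hf]
        refine lintegral_congr fun z => ?_
        rw [lintegral_fintype]
        exact Finset.sum_congr rfl fun y _ => mul_comm _ _
    _ = _ := by
        rw [lintegral_map hk hZ]
        refine lintegral_congr fun ω => Finset.sum_congr rfl fun y _ => ?_
        rw [condProb, ofReal_measureReal (measure_ne_top _ _)]

/-- A disintegration of the law of `(Y, Z)` over `Z` is the conditional law of `Y` given `Z`. -/
lemma condProb_ae_eq [StandardBorelSpace S] [Nonempty S] [Fintype S]
    [MeasurableSingletonClass S] (μ : Measure Ω) [IsFiniteMeasure μ] {Y : Ω → S} {Z : Ω → T}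
    (hY : Measurable Y) (hZ : Measurable Z) (q : S → T → ℝ≥0∞) (hq : ∀ y, Measurable (q y))
    (h : ∀ g : S → T → ℝ≥0∞, (∀ y, Measurable (g y)) →
      ∫⁻ ω, g (Y ω) (Z ω) ∂μ = ∫⁻ ω, ∑ y, q y (Z ω) * g y (Z ω) ∂μ) :
    ∀ᵐ ω ∂μ, ∀ y, condProb μ Y Z y ω = (q y (Z ω)).toReal := by
  classical
  rw [ae_all_iff]
  intro y
  have hR : Measurable fun z => (condDistrib Y Z μ z) {y} :=
    (condDistrib Y Z μ).measurable_coe (measurableSet_singleton y)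
  suffices (fun z => (condDistrib Y Z μ z) {y}) =ᵐ[μ.map Z] q y by
    filter_upwards [ae_of_ae_map hZ.aemeasurable this] with ω hω
    rw [condProb, measureReal_def, hω]
  refine ae_eq_of_forall_setLIntegral_eq_of_sigmaFinite hR (hq y) fun s hs _ => ?_
  -- Testing the hypothesis on the indicator of {y} × s isolates the integral over `s` of each
  -- candidate density.
  let g : S → T → ℝ≥0∞ := fun y' => if y' = y then s.indicator 1 else 0
  have hg : ∀ y', Measurable (g y') := by
    intro y'
    simp only [g]
    split_ifs
    · exact measurable_one.indicator hs
    · exact measurable_zero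
  have hsum : ∀ (r : S → T → ℝ≥0∞) z, ∑ y', r y' z * g y' z = s.indicator (r y) z := by
    intro r z
    rw [Finset.sum_eq_single y (fun y' _ hy' => by simp [g, hy']) (by simp)]
    by_cases hz : z ∈ s <;> simp [g, hz]
  have h1 := lintegral_comp_eq_condProb μ hY hZ g hg
  rw [h g hg] at h1
  simp only [condProb, ofReal_measureReal (measure_ne_top _ _)] at h1
  rw [lintegral_congr fun ω => hsum q (Z ω),
    lintegral_congr fun ω => hsum (fun y z => (condDistrib Y Z μ z) {y}) (Z ω)] at h1
  rw [← lintegral_indicator hs, ← lintegral_indicator hs, lintegral_map (hR.indicator hs) hZ,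
    lintegral_map ((hq y).indicator hs) hZ]
  exact h1.symm

/-- The outputs and inputs of the first `k` rounds. -/
def history {n : ℕ} (A : Fin n → Ω → Bool) (X : Fin n → Ω → Fin 2) {k : ℕ} (hk : k ≤ n) (ω : Ω) :
    Fin k → Bool × Fin 2 :=
  fun j => (A (Fin.castLE hk j) ω, X (Fin.castLE hk j) ω)

variable {μ : Measure Ω} [IsProbabilityMeasure μ] {n : ℕ} {A : Fin n → Ω → Bool}
  {X : Fin n → Ω → Fin 2} {Λ : Ω → L}
  {E en : (i : Fin n) → (Fin i.val → Bool × Fin 2) → L → Fin 2 → ℝ}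
  {p ωpk ωavg : Fin 2 → ℝ} {εω : ℝ}

lemma measurable_outProb (hE : ∀ i w, Measurable (E i w)) (i : Fin n)
    (w : Fin i.val → Bool × Fin 2) (a : Bool) (x : Fin 2) :
    Measurable fun l => outProb (E i w l) a x := by
  have : Measurable fun l => E i w l x := (measurable_pi_apply x).comp (hE i w)
  unfold outProb
  fun_prop

/-! ### Averaging over single rounds of the model -/

namespace NRoundModel

lemma measurable_history (h : NRoundModel μ A X Λ E en p ωpk ωavg εω) {k : ℕ} (hk : k ≤ n) :
    Measurable (history A X hk) :=
  measurable_pi_lambda _ fun _ => (h.measurable_A _).prodMk (h.measurable_X _)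

lemma measurable_round (h : NRoundModel μ A X Λ E en p ωpk ωavg εω) (i : Fin n)
    {B : Type*} [MeasurableSpace B] (g : Bool → Fin 2 → (Fin i.val → Bool × Fin 2) → L → B)
    (hg : ∀ a x w, Measurable (g a x w)) :
    Measurable fun ω => g (A i ω) (X i ω) (past A X i ω) (Λ ω) := by
  have hf : Measurable fun q : Bool × Fin 2 × (Fin i.val → Bool × Fin 2) × L =>
      g q.1 q.2.1 q.2.2.1 q.2.2.2 :=
    measurable_from_prod_countable_right fun a => measurable_from_prod_countable_right fun x =>
      measurable_from_prod_countable_right fun w => hg a x w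
  exact hf.comp ((h.measurable_A i).prodMk ((h.measurable_X i).prodMk
    ((h.measurable_history i.isLt.le).prodMk h.measurable_Λ)))

/-- Averaging over the input of round `i`. -/
lemma lintegral_input (h : NRoundModel μ A X Λ E en p ωpk ωavg εω) (i : Fin n)
    (g : Fin 2 → (Fin i.val → Bool × Fin 2) → L → ℝ≥0∞) (hg : ∀ x w, Measurable (g x w)) :
    ∫⁻ ω, g (X i ω) (past A X i ω) (Λ ω) ∂μ
      = ∫⁻ ω, ∑ x, ENNReal.ofReal (p x) * g x (past A X i ω) (Λ ω) ∂μ := by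
  have hZ : Measurable fun ω => (past A X i ω, Λ ω) :=
    (h.measurable_history i.isLt.le).prodMk h.measurable_Λ
  rw [lintegral_comp_eq_condProb μ (h.measurable_X i) hZ (fun x q => g x q.1 q.2)
    fun x => measurable_from_prod_countable_right (hg x)]
  refine lintegral_congr_ae ?_
  filter_upwards [ae_all_iff.2 (h.input i)] with ω hω
  simp only [hω]

/-- Averaging over the output of round `i`. -/
lemma lintegral_output (h : NRoundModel μ A X Λ E en p ωpk ωavg εω) (i : Fin n)
    (g : Bool → Fin 2 → (Fin i.val → Bool × Fin 2) → L → ℝ≥0∞)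
    (hg : ∀ a x w, Measurable (g a x w)) :
    ∫⁻ ω, g (A i ω) (X i ω) (past A X i ω) (Λ ω) ∂μ
      = ∫⁻ ω, ∑ a, ENNReal.ofReal (outProb (E i (past A X i ω) (Λ ω)) a (X i ω))
          * g a (X i ω) (past A X i ω) (Λ ω) ∂μ := by
  have hZ : Measurable fun ω => (X i ω, past A X i ω, Λ ω) :=
    (h.measurable_X i).prodMk ((h.measurable_history i.isLt.le).prodMk h.measurable_Λ)
  rw [lintegral_comp_eq_condProb μ (h.measurable_A i) hZ (fun a q => g a q.1 q.2.1 q.2.2)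
    fun a => measurable_from_prod_countable_right fun x =>
      measurable_from_prod_countable_right (hg a x)]
  refine lintegral_congr_ae ?_
  filter_upwards [ae_all_iff.2 (h.output i)] with ω hω
  simp only [hω]

/-- Averaging over the input and the output of round `i`. -/
lemma lintegral_round (h : NRoundModel μ A X Λ E en p ωpk ωavg εω) (i : Fin n)
    (g : Bool → Fin 2 → (Fin i.val → Bool × Fin 2) → L → ℝ≥0∞)
    (hg : ∀ a x w, Measurable (g a x w)) :
    ∫⁻ ω, g (A i ω) (X i ω) (past A X i ω) (Λ ω) ∂μ
      = ∫⁻ ω, ∑ x, ENNReal.ofReal (p x) * ∑ a,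
          ENNReal.ofReal (outProb (E i (past A X i ω) (Λ ω)) a x)
            * g a x (past A X i ω) (Λ ω) ∂μ := by
  rw [h.lintegral_output i g hg]
  exact h.lintegral_input i
    (fun x w l => ∑ a, ENNReal.ofReal (outProb (E i w l) a x) * g a x w l)
    fun x w => Finset.measurable_sum _ fun a _ =>
      (measurable_outProb h.measurable_E i w a x).ennreal_ofReal.mul (hg a x w)

/-- The probabilities of both outputs are nonnegative, for both inputs. -/
lemma ae_outProb_nonneg (h : NRoundModel μ A X Λ E en p ωpk ωavg εω) (hp : ∀ x, 0 < p x)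
    (i : Fin n) : ∀ᵐ ω ∂μ, ∀ a x, 0 ≤ outProb (E i (past A X i ω) (Λ ω)) a x := by
  rw [ae_all_iff]
  intro a
  let g : Fin 2 → (Fin i.val → Bool × Fin 2) → L → ℝ≥0∞ := fun x w =>
    Set.indicator {l | outProb (E i w l) a x < 0} 1
  have hg : ∀ x w, Measurable (g x w) := fun x w => measurable_one.indicator
    (measurableSet_lt (measurable_outProb h.measurable_E i w a x) measurable_const)
  have h0 : ∫⁻ ω, g (X i ω) (past A X i ω) (Λ ω) ∂μ = 0 := by
    rw [← lintegral_zero (μ := μ)]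
    refine lintegral_congr_ae ?_
    filter_upwards [h.output i a] with ω hω
    have : 0 ≤ outProb (E i (past A X i ω) (Λ ω)) a (X i ω) := hω ▸ measureReal_nonneg
    simp [g, this]
  -- The model speaks only of the input that occurred. Since every input has positive weight, a
  -- violation at any x would contribute to this average.
  rw [h.lintegral_input i g hg, lintegral_eq_zero_iff
    (Finset.measurable_sum _ fun x _ =>
      (h.measurable_round i (fun _ _ => g x) fun _ _ => hg x).const_mul _)] at h0
  filter_upwards [h0] with ω hω x
  simp only [Pi.zero_apply, Finset.sum_eq_zero_iff, Finset.mem_univ, true_imp_iff, mul_eq_zero,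
    ENNReal.ofReal_eq_zero, (hp _).not_ge, false_or] at hω
  by_contra hlt
  have := hω x
  simp [g, not_le.1 hlt] at this

/-- Outputs of probability zero do not occur. -/
lemma ae_outProb_pos (h : NRoundModel μ A X Λ E en p ωpk ωavg εω) (i : Fin n) :
    ∀ᵐ ω ∂μ, 0 < outProb (E i (past A X i ω) (Λ ω)) (A i ω) (X i ω) := by
  let g : Bool → Fin 2 → (Fin i.val → Bool × Fin 2) → L → ℝ≥0∞ := fun a x w =>
    Set.indicator {l | outProb (E i w l) a x ≤ 0} 1
  have hg : ∀ a x w, Measurable (g a x w) := fun a x w => measurable_one.indicator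
    (measurableSet_le (measurable_outProb h.measurable_E i w a x) measurable_const)
  have h0 : ∫⁻ ω, g (A i ω) (X i ω) (past A X i ω) (Λ ω) ∂μ = 0 := by
    rw [h.lintegral_output i g hg, ← lintegral_zero (μ := μ)]
    refine lintegral_congr fun ω => Finset.sum_eq_zero fun a _ => ?_
    by_cases ha : outProb (E i (past A X i ω) (Λ ω)) a (X i ω) ≤ 0
    · rw [ENNReal.ofReal_of_nonpos ha, zero_mul]
    · simp [g, ha]
  rw [lintegral_eq_zero_iff (h.measurable_round i g hg)] at h0
  filter_upwards [h0] with ω hω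
  by_contra hle
  simp [g, not_lt.1 hle] at hω

/-- A product of one-round factors, each of conditional mean at most one given the past, has mean
at most one. -/
lemma lintegral_prod_le_one (h : NRoundModel μ A X Λ E en p ωpk ωavg εω)
    (g : (i : Fin n) → Bool → Fin 2 → (Fin i.val → Bool × Fin 2) → L → ℝ≥0∞)
    (hg : ∀ i a x w, Measurable (g i a x w))
    (hg1 : ∀ i, ∀ᵐ ω ∂μ, ∑ x, ENNReal.ofReal (p x) * ∑ a,
      ENNReal.ofReal (outProb (E i (past A X i ω) (Λ ω)) a x)
        * g i a x (past A X i ω) (Λ ω) ≤ 1) :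
    ∫⁻ ω, ∏ i, g i (A i ω) (X i ω) (past A X i ω) (Λ ω) ∂μ ≤ 1 := by
  -- The partial product depends only on the history and Λ, so it factors out of the average over
  -- the next round: a supermartingale argument.
  let G : (k : ℕ) → k ≤ n → (Fin k → Bool × Fin 2) → L → ℝ≥0∞ := fun k hk w l =>
    ∏ j : Fin k, g (Fin.castLE hk j) (w j).1 (w j).2 (fun m => w (Fin.castLE j.isLt.le m)) l
  have hG : ∀ k (hk : k ≤ n) w, Measurable (G k hk w) := fun k hk w =>
    Finset.measurable_prod _ fun j _ => hg _ _ _ _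
  suffices ∀ k (hk : k ≤ n), ∫⁻ ω, G k hk (history A X hk ω) (Λ ω) ∂μ ≤ 1 from this n le_rfl
  intro k
  induction k with
  | zero => intro hk; simp [G]
  | succ k ih =>
    intro hk
    let i : Fin n := ⟨k, hk⟩
    have hstep : ∀ ω, G (k + 1) hk (history A X hk ω) (Λ ω)
        = G k i.isLt.le (past A X i ω) (Λ ω) * g i (A i ω) (X i ω) (past A X i ω) (Λ ω) :=
      fun ω => Fin.prod_univ_castSucc _
    simp_rw [hstep]
    rw [h.lintegral_round i (fun a x w l => G k i.isLt.le w l * g i a x w l)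
      fun a x w => (hG _ _ _).mul (hg _ _ _ _)]
    refine le_trans (lintegral_mono_ae ?_) (ih i.isLt.le)
    filter_upwards [hg1 i] with ω hω
    calc _ = G k i.isLt.le (past A X i ω) (Λ ω) * ∑ x, ENNReal.ofReal (p x) * ∑ a,
          ENNReal.ofReal (outProb (E i (past A X i ω) (Λ ω)) a x)
            * g i a x (past A X i ω) (Λ ω) := by
          simp only [Finset.mul_sum]
          refine Finset.sum_congr rfl fun x _ => Finset.sum_congr rfl fun a _ => ?_
          ring
      _ ≤ G k i.isLt.le (past A X i ω) (Λ ω) * 1 := by gcongr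
      _ = _ := mul_one _

end NRoundModel

/-- The probability of the outputs `a` of the first `k` rounds, given the inputs `x`. -/
noncomputable def seqProb (E : (i : Fin n) → (Fin i.val → Bool × Fin 2) → L → Fin 2 → ℝ) {k : ℕ}
    (hk : k ≤ n) (a : Fin k → Bool) (x : Fin k → Fin 2) (l : L) : ℝ≥0∞ :=
  ∏ j : Fin k, ENNReal.ofReal (outProb (E (Fin.castLE hk j)
    (fun m => (a (Fin.castLE j.isLt.le m), x (Fin.castLE j.isLt.le m))) l) (a j) (x j))

lemma measurable_seqProb (hE : ∀ i w, Measurable (E i w)) {k : ℕ} (hk : k ≤ n) (a : Fin k → Bool)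
    (x : Fin k → Fin 2) : Measurable (seqProb E hk a x) :=
  Finset.measurable_prod _ fun _ _ => (measurable_outProb hE _ _ _ _).ennreal_ofReal

lemma seqProb_snoc {M : Type*}
    {E : (i : Fin n) → (Fin i.val → Bool × Fin 2) → M → Fin 2 → ℝ} {k : ℕ} (hk : k + 1 ≤ n) (a : Fin k → Bool) (x : Fin k → Fin 2) (b : Bool)
    (y : Fin 2) (l : M) :
    seqProb E hk (Fin.snoc a b) (Fin.snoc x y) l = seqProb E (Nat.le_of_succ_le hk) a x l
      * ENNReal.ofReal (outProb (E ⟨k, hk⟩ (fun m => (a m, x m)) l) b y) := by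
  have hc : ∀ (B : Type) (f : Fin k → B) (c : B) (j : ℕ) (hj : j ≤ k) (m : Fin j),
      (Fin.snoc f c : Fin (k + 1) → B) (Fin.castLE (hj.trans k.le_succ) m) = f (Fin.castLE hj m) :=
    fun B f c j hj m => Fin.snoc_castSucc (α := fun _ => B) c f (Fin.castLE hj m)
  unfold seqProb
  rw [Fin.prod_univ_castSucc]
  congr 1
  · refine Finset.prod_congr rfl fun j _ => ?_
    rw [Fin.snoc_castSucc, Fin.snoc_castSucc]
    congr 3
    funext m
    exact Prod.ext (hc _ a b j j.isLt.le m) (hc _ x y j j.isLt.le m)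
  · rw [Fin.snoc_last, Fin.snoc_last]
    congr 3
    funext m
    exact Prod.ext (hc _ a b k le_rfl m) (hc _ x y k le_rfl m)

/-- The last input has law p whatever the past, so it can be averaged out, the earlier outputs
summed by induction, and the input restored. In other words, later inputs carry no information about
earlier outputs. -/
lemma NRoundModel.lintegral_outputs (h : NRoundModel μ A X Λ E en p ωpk ωavg εω) {k : ℕ}
    (hk : k ≤ n) (F : (Fin k → Bool) → (Fin k → Fin 2) → L → ℝ≥0∞)
    (hF : ∀ a x, Measurable (F a x)) :
    ∫⁻ ω, F (fun j => A (Fin.castLE hk j) ω) (fun j => X (Fin.castLE hk j) ω) (Λ ω) ∂μ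
      = ∫⁻ ω, ∑ a, seqProb E hk a (fun j => X (Fin.castLE hk j) ω) (Λ ω)
          * F a (fun j => X (Fin.castLE hk j) ω) (Λ ω) ∂μ := by
  induction k with
  | zero =>
    refine lintegral_congr fun ω => ?_
    rw [Fintype.sum_subsingleton _ (fun j => A (Fin.castLE hk j) ω)]
    simp [seqProb]
  | succ k ih =>
    let i : Fin n := ⟨k, hk⟩
    have hk' : k ≤ n := i.isLt.le
    have hsplit : ∀ (B : Type) (f : Fin n → B), (fun j : Fin (k + 1) => f (Fin.castLE hk j))
        = Fin.snoc (fun j : Fin k => f (Fin.castLE hk' j)) (f i) := by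
      intro B f
      funext j
      refine Fin.lastCases ?_ (fun j => ?_) j
      · rw [Fin.snoc_last]; rfl
      · rw [Fin.snoc_castSucc]; rfl
    have hA : ∀ ω, (fun j : Fin (k + 1) => A (Fin.castLE hk j) ω)
        = Fin.snoc (fun j : Fin k => A (Fin.castLE hk' j) ω) (A i ω) :=
      fun ω => hsplit Bool fun j => A j ω
    have hX : ∀ ω, (fun j : Fin (k + 1) => X (Fin.castLE hk j) ω)
        = Fin.snoc (fun j : Fin k => X (Fin.castLE hk' j) ω) (X i ω) :=
      fun ω => hsplit (Fin 2) fun j => X j ω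
    let K : (Fin k → Bool) → (Fin k → Fin 2) → Fin 2 → L → ℝ≥0∞ := fun a' x' x l =>
      ∑ a, ENNReal.ofReal (outProb (E i (fun m => (a' m, x' m)) l) a x)
        * F (Fin.snoc a' a) (Fin.snoc x' x) l
    have hK : ∀ a' x' x, Measurable (K a' x' x) := fun a' x' x =>
      Finset.measurable_sum _ fun a _ =>
        (measurable_outProb h.measurable_E i _ a x).ennreal_ofReal.mul (hF _ _)
    calc _ = ∫⁻ ω, F (Fin.snoc (fun j : Fin k => (past A X i ω j).1) (A i ω))
            (Fin.snoc (fun j : Fin k => (past A X i ω j).2) (X i ω)) (Λ ω) ∂μ :=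
          lintegral_congr fun ω => by rw [hA, hX]; rfl
      _ = ∫⁻ ω, ∑ x, ENNReal.ofReal (p x) * K (fun j => A (Fin.castLE hk' j) ω)
            (fun j => X (Fin.castLE hk' j) ω) x (Λ ω) ∂μ :=
          h.lintegral_round i (fun a x w l => F (Fin.snoc (fun j : Fin k => (w j).1) a)
            (Fin.snoc (fun j : Fin k => (w j).2) x) l) fun _ _ _ => hF _ _
      _ = ∫⁻ ω, ∑ a', seqProb E hk' a' (fun j => X (Fin.castLE hk' j) ω) (Λ ω)
            * ∑ x, ENNReal.ofReal (p x) * K a' (fun j => X (Fin.castLE hk' j) ω) x (Λ ω) ∂μ :=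
          ih hk' (fun a' x' l => ∑ x, ENNReal.ofReal (p x) * K a' x' x l) fun a' x' =>
            Finset.measurable_sum _ fun x _ => (hK a' x' x).const_mul _
      _ = ∫⁻ ω, ∑ x, ENNReal.ofReal (p x)
            * ∑ a', seqProb E hk' a' (fun j => X (Fin.castLE hk' j) ω) (Λ ω)
              * K a' (fun j => X (Fin.castLE hk' j) ω) x (Λ ω) ∂μ := by
          refine lintegral_congr fun ω => ?_
          simp only [Finset.mul_sum (s := Finset.univ (α := Fin 2)),
            Finset.mul_sum (s := Finset.univ (α := Fin k → Bool))]
          rw [Finset.sum_comm]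
          refine Finset.sum_congr rfl fun x _ => Finset.sum_congr rfl fun a _ => ?_
          ring
      _ = ∫⁻ ω, ∑ a', seqProb E hk' a' (fun j => X (Fin.castLE hk' j) ω) (Λ ω)
              * K a' (fun j => X (Fin.castLE hk' j) ω) (X i ω) (Λ ω) ∂μ :=
          (h.lintegral_input i (fun x w l => ∑ a', seqProb E hk' a' (fun j : Fin k => (w j).2) l
            * K a' (fun j : Fin k => (w j).2) x l) fun x w => Finset.measurable_sum _ fun a' _ =>
              (measurable_seqProb h.measurable_E hk' _ _).mul (hK _ _ _)).symm
      _ = _ := by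
          refine lintegral_congr fun ω => ?_
          rw [hX, ← (Fin.snocEquiv fun _ : Fin (k + 1) => Bool).sum_comp, Fintype.sum_prod_type,
            Finset.sum_comm]
          refine Finset.sum_congr rfl fun a' _ => ?_
          rw [Finset.mul_sum]
          refine Finset.sum_congr rfl fun a _ => ?_
          simp only [Fin.snocEquiv, Equiv.coe_fn_mk]
          rw [seqProb_snoc, mul_assoc]

/-- The conditional probability of all outputs is the product of the one-round probabilities. -/
lemma NRoundModel.ae_condProb_eq (h : NRoundModel μ A X Λ E en p ωpk ωavg εω)
    (hp : ∀ x, 0 < p x) :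
    ∀ᵐ ω ∂μ, condProb μ (fun ω i => A i ω) (fun ω => ((fun i => X i ω), Λ ω)) (fun i => A i ω) ω
      = ∏ i, outProb (E i (past A X i ω) (Λ ω)) (A i ω) (X i ω) := by
  have hZ : Measurable fun ω => ((fun i => X i ω), Λ ω) :=
    (measurable_pi_lambda _ h.measurable_X).prodMk h.measurable_Λ
  have key := condProb_ae_eq μ (measurable_pi_lambda _ h.measurable_A) hZ
    (fun a z => seqProb E le_rfl a z.1 z.2)
    (fun a => measurable_from_prod_countable_right fun x =>
      measurable_seqProb h.measurable_E le_rfl a x)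
    (fun g hg => h.lintegral_outputs le_rfl (fun a x l => g a (x, l))
      fun a x => (hg a).comp measurable_prodMk_left)
  filter_upwards [key, ae_all_iff.2 (h.ae_outProb_nonneg hp)] with ω hω hpos
  rw [hω, seqProb, ENNReal.toReal_prod]
  exact Finset.prod_congr rfl fun i _ => ENNReal.toReal_ofReal (hpos i _ _)

end Disintegration

/-! ### One round -/

section Round

variable {p α β γ E e : Fin 2 → ℝ}

lemma xi_le_xiMax (p α β : Fin 2 → ℝ) (a : Bool) (x : Fin 2) : xi p α β a x ≤ xiMax p α β :=
  le_ciSup (f := fun q : Bool × Fin 2 => xi p α β q.1 q.2) (Set.finite_range _).bddAbove (a, x)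

lemma xiMin_le_xi (p α β : Fin 2 → ℝ) (a : Bool) (x : Fin 2) : xiMin p α β ≤ xi p α β a x :=
  ciInf_le (f := fun q : Bool × Fin 2 => xi p α β q.1 q.2) (Set.finite_range _).bddBelow (a, x)

lemma sum_outProb (E : Fin 2 → ℝ) (x : Fin 2) : ∑ a, outProb E a x = 1 := by
  simp only [Fintype.sum_bool, outProb, sgn, if_true]
  norm_num
  ring

lemma outProb_le_one (hE : ∀ a x, 0 ≤ outProb E a x) (a : Bool) (x : Fin 2) :
    outProb E a x ≤ 1 := by
  rw [← sum_outProb E x]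
  exact Finset.single_le_sum (f := fun a => outProb E a x) (fun a _ => hE a x) (Finset.mem_univ a)

/-- The joint law of output and input in one round. -/
noncomputable def roundLaw (p E : Fin 2 → ℝ) (s : Bool × Fin 2) : ℝ := p s.2 * outProb E s.1 s.2

/-- The amount by which the round `(a, x)` violates the trade-off inequality. -/
noncomputable def roundScore (p α β γ E e : Fin 2 → ℝ) (a : Bool) (x : Fin 2) : ℝ :=
  xi p α β a x + ∑ y, γ y * e y + Real.logb 2 (outProb E a x)

lemma sum_roundLaw_mul (f : Bool × Fin 2 → ℝ) :
    ∑ s, roundLaw p E s * f s = ∑ x, p x * ∑ a, outProb E a x * f (a, x) := by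
  rw [Fintype.sum_prod_type, Finset.sum_comm]
  refine Finset.sum_congr rfl fun x _ => ?_
  rw [Finset.mul_sum]
  refine Finset.sum_congr rfl fun a _ => ?_
  rw [roundLaw, mul_assoc]

lemma roundLaw_nonneg (hp : ∀ x, 0 < p x) (hE : ∀ a x, 0 ≤ outProb E a x) (s : Bool × Fin 2) :
    0 ≤ roundLaw p E s :=
  mul_nonneg (hp _).le (hE _ _)

lemma sum_roundLaw (hp1 : ∑ x, p x = 1) : ∑ s, roundLaw p E s = 1 := by
  have := sum_roundLaw_mul (p := p) (E := E) fun _ => 1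
  simpa only [mul_one, sum_outProb, hp1] using this

lemma sum_roundLaw_mul_le (hp : ∀ x, 0 < p x) (hp1 : ∑ x, p x = 1) {f : Bool × Fin 2 → ℝ} {c : ℝ}
    (hf : ∀ x, ∑ a, outProb E a x * f (a, x) ≤ c) : ∑ s, roundLaw p E s * f s ≤ c := by
  rw [sum_roundLaw_mul]
  calc ∑ x, p x * ∑ a, outProb E a x * f (a, x) ≤ ∑ x, p x * c := by
        gcongr with x
        · exact (hp x).le
        · exact hf x
    _ = c := by rw [← Finset.sum_mul, hp1, one_mul]

lemma sum_roundLaw_mul_xi (hp : ∀ x, 0 < p x) :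
    ∑ s, roundLaw p E s * xi p α β s.1 s.2 = ∑ x, α x + ∑ x, β x * E x := by
  rw [sum_roundLaw_mul, ← Finset.sum_add_distrib]
  refine Finset.sum_congr rfl fun x _ => ?_
  have := (hp x).ne'
  simp only [Fintype.sum_bool, outProb, xi, sgn, if_true, Bool.false_eq_true, if_false]
  field_simp
  ring

lemma sum_roundLaw_mul_logb :
    ∑ s, roundLaw p E s * Real.logb 2 (outProb E s.1 s.2) = -entropy p E := by
  rw [entropy, neg_neg, Fintype.sum_prod_type]
  rfl

/-- This is binary entropy, at most one bit. -/
lemma neg_sum_outProb_mul_logb_le (E : Fin 2 → ℝ) (x : Fin 2) :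
    ∑ a, outProb E a x * -Real.logb 2 (outProb E a x) ≤ 1 := by
  have h1 : outProb E false x = 1 - outProb E true x := by
    have := sum_outProb E x
    rw [Fintype.sum_bool] at this
    linarith
  have h2 := Real.binEntropy_le_log_two (p := outProb E true x)
  rw [Real.binEntropy_eq_negMulLog_add_negMulLog_one_sub] at h2
  have h3 : 0 < Real.log 2 := Real.log_pos one_lt_two
  rw [Fintype.sum_bool, h1, Real.logb, Real.logb]
  rw [Real.negMulLog, Real.negMulLog] at h2
  calc _ = (-outProb E true x * Real.log (outProb E true x)
        + -(1 - outProb E true x) * Real.log (1 - outProb E true x)) / Real.log 2 := by ring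
    _ ≤ Real.log 2 / Real.log 2 := by gcongr
    _ = 1 := div_self h3.ne'

lemma sum_outProb_mul_logb_sq_le (hE : ∀ a x, 0 ≤ outProb E a x) (x : Fin 2) :
    ∑ a, outProb E a x * Real.logb 2 (outProb E a x) ^ 2
      ≤ 4 * (Fintype.card Bool : ℝ) / Real.exp 1 ^ 2 * Real.logb 2 (Real.exp 1) ^ 2 := by
  have h : ∀ a, outProb E a x * Real.logb 2 (outProb E a x) ^ 2
      ≤ 4 / Real.exp 1 ^ 2 * Real.logb 2 (Real.exp 1) ^ 2 := by
    intro a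
    have h1 := mul_log_sq_le (hE a x) (outProb_le_one hE a x)
    simp only [Real.logb, Real.log_exp]
    calc _ = outProb E a x * Real.log (outProb E a x) ^ 2 * (1 / Real.log 2) ^ 2 := by ring
      _ ≤ _ := by gcongr
  refine (Finset.sum_le_sum fun a _ => h a).trans (le_of_eq ?_)
  simp
  ring

lemma logb_two_card_bool : Real.logb 2 (Fintype.card Bool) = 1 := by
  simp

/-- Expanding the square yields the three terms of V. As log p ≤ 0, the cross term 2(ξ+γ̄) log p is
positive only where ξ + γ̄ < 0; its mean is controlled by the entropy bound. -/
lemma sum_roundLaw_mul_sq_le (hp : ∀ x, 0 < p x) (hp1 : ∑ x, p x = 1)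
    (hE : ∀ a x, 0 ≤ outProb E a x) :
    ∑ s, roundLaw p E s * (xi p α β s.1 s.2 + ∑ y, γ y + Real.logb 2 (outProb E s.1 s.2)) ^ 2
      ≤ varBound p α β γ := by
  rw [varBound, logb_two_card_bool, one_mul]
  set g := ∑ y, γ y
  set m₁ := max ((xiMax p α β + g) ^ 2) ((xiMin p α β + g) ^ 2) with hm₁
  set K := max (-(g + xiMin p α β)) 0 with hK
  set c := 4 * (Fintype.card Bool : ℝ) / Real.exp 1 ^ 2 * Real.logb 2 (Real.exp 1) ^ 2
  have hpt : ∀ s : Bool × Fin 2,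
      (xi p α β s.1 s.2 + g + Real.logb 2 (outProb E s.1 s.2)) ^ 2
        ≤ m₁ + 2 * K * -Real.logb 2 (outProb E s.1 s.2) + Real.logb 2 (outProb E s.1 s.2) ^ 2 := by
    rintro ⟨a, x⟩
    have hl : Real.logb 2 (outProb E a x) ≤ 0 :=
      Real.logb_nonpos one_lt_two (hE a x) (outProb_le_one hE a x)
    have h1 := xi_le_xiMax p α β a x
    have h2 := xiMin_le_xi p α β a x
    have h3 : (xi p α β a x + g) ^ 2 ≤ m₁ := by
      rcases le_total 0 (xi p α β a x + g) with h | h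
      · exact (pow_le_pow_left₀ h (by linarith) 2).trans (le_max_left _ _)
      · refine le_trans ?_ (le_max_right _ _)
        nlinarith
    have h4 : -(xi p α β a x + g) ≤ K := le_trans (by linarith) (le_max_left _ _)
    nlinarith
  calc _ ≤ ∑ s, roundLaw p E s * (m₁ + 2 * K * -Real.logb 2 (outProb E s.1 s.2)
          + Real.logb 2 (outProb E s.1 s.2) ^ 2) := by
        gcongr with s
        · exact roundLaw_nonneg hp hE s
        · exact hpt s
    _ = m₁ * ∑ s, roundLaw p E s
          + 2 * K * ∑ s, roundLaw p E s * -Real.logb 2 (outProb E s.1 s.2)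
          + ∑ s, roundLaw p E s * Real.logb 2 (outProb E s.1 s.2) ^ 2 := by
        rw [Finset.mul_sum, Finset.mul_sum, ← Finset.sum_add_distrib, ← Finset.sum_add_distrib]
        refine Finset.sum_congr rfl fun s _ => ?_
        ring
    _ ≤ m₁ * 1 + 2 * K * 1 + c := by
        have hK0 : 0 ≤ K := le_max_right _ _
        gcongr
        · exact (sum_roundLaw hp1).le
        · exact sum_roundLaw_mul_le hp hp1 (f := fun s => -Real.logb 2 (outProb E s.1 s.2))
            fun x => neg_sum_outProb_mul_logb_le E x
        · exact sum_roundLaw_mul_le hp hp1 (f := fun s => Real.logb 2 (outProb E s.1 s.2) ^ 2)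
            fun x => sum_outProb_mul_logb_sq_le hE x
    _ = _ := by ring

/-- Here e² < 8 and log₂ e ≥ 1. This supplies the 1 that completes the square in
`neg_xiMin_le_sqrt_varBound`. -/
lemma one_le_entropy_const :
    1 ≤ 4 * (Fintype.card Bool : ℝ) / Real.exp 1 ^ 2 * Real.logb 2 (Real.exp 1) ^ 2 := by
  have he := Real.exp_one_lt_d9
  have he0 := Real.exp_one_gt_d9
  have h1 : 1 ≤ Real.logb 2 (Real.exp 1) := by
    rw [Real.le_logb_iff_rpow_le one_lt_two (Real.exp_pos _), Real.rpow_one]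
    linarith
  have h2 : 1 ≤ 4 * (Fintype.card Bool : ℝ) / Real.exp 1 ^ 2 := by
    rw [one_le_div (by positivity), Fintype.card_bool]
    push_cast
    nlinarith
  exact one_le_mul_of_one_le_of_one_le h2 (one_le_pow₀ h1)

lemma varBound_pos : 0 < varBound p α β γ := by
  have h1 := one_le_entropy_const
  have h2 : 0 ≤ max ((xiMax p α β + ∑ x, γ x) ^ 2) ((xiMin p α β + ∑ x, γ x) ^ 2) :=
    (sq_nonneg _).trans (le_max_left _ _)
  have h3 : 0 ≤ max (-(Real.logb 2 (Fintype.card Bool) * (∑ x, γ x + xiMin p α β))) 0 :=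
    le_max_right _ _
  rw [varBound]
  linarith

/-- The numbers ξ⁺ + γ̄ and ξ⁻ + γ̄ are at least ξ⁺ apart, so one of them has absolute value at
least ξ⁺/2. -/
lemma xiMax_le_two_mul_sqrt_varBound (hm : xiMin p α β ≤ 0) (hM : 0 ≤ xiMax p α β) :
    xiMax p α β ≤ 2 * √(varBound p α β γ) := by
  have h0 := one_le_entropy_const
  have h1 := le_max_left ((xiMax p α β + ∑ x, γ x) ^ 2) ((xiMin p α β + ∑ x, γ x) ^ 2)
  have h2 := le_max_right ((xiMax p α β + ∑ x, γ x) ^ 2) ((xiMin p α β + ∑ x, γ x) ^ 2)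
  have h3 : 0 ≤ max (-(Real.logb 2 (Fintype.card Bool) * (∑ x, γ x + xiMin p α β))) 0 :=
    le_max_right _ _
  have h4 : (xiMax p α β / 2) ^ 2 ≤ varBound p α β γ := by
    rw [varBound]
    nlinarith [sq_nonneg (xiMax p α β + ∑ x, γ x + (xiMin p α β + ∑ x, γ x))]
  linarith [Real.le_sqrt_of_sq_le h4]

/-- With z = −ξ⁻ − γ̄, the terms of V dominate z² + 2z + 1. The left side bounds the drift of a
round, whose entropy and energies are at most 1. -/
lemma neg_xiMin_le_sqrt_varBound :
    1 - xiMin p α β - ∑ x, γ x ≤ √(varBound p α β γ) := by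
  have h0 := one_le_entropy_const
  have h2 := le_max_right ((xiMax p α β + ∑ x, γ x) ^ 2) ((xiMin p α β + ∑ x, γ x) ^ 2)
  have h3 := le_max_left (-(∑ x, γ x + xiMin p α β)) 0
  refine Real.le_sqrt_of_sq_le ?_
  rw [varBound, logb_two_card_bool, one_mul]
  nlinarith

lemma entropy_le_one (hp : ∀ x, 0 < p x) (hp1 : ∑ x, p x = 1) : entropy p E ≤ 1 := by
  rw [← neg_neg (entropy p E), ← sum_roundLaw_mul_logb, ← Finset.sum_neg_distrib]
  simp only [← mul_neg]
  exact sum_roundLaw_mul_le hp hp1 (f := fun s => -Real.logb 2 (outProb E s.1 s.2))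
    fun x => neg_sum_outProb_mul_logb_le E x

lemma xiMin_le_mean (hp : ∀ x, 0 < p x) (hp1 : ∑ x, p x = 1) (hE : ∀ a x, 0 ≤ outProb E a x) :
    xiMin p α β ≤ ∑ x, α x + ∑ x, β x * E x := by
  rw [← sum_roundLaw_mul_xi (E := E) hp]
  calc xiMin p α β = ∑ s, roundLaw p E s * xiMin p α β := by
        rw [← Finset.sum_mul, sum_roundLaw hp1, one_mul]
    _ ≤ _ := by
        gcongr with s
        · exact roundLaw_nonneg hp hE s
        · exact xiMin_le_xi _ _ _ _ _

lemma sum_roundLaw_mul_roundScore (hp : ∀ x, 0 < p x) (hp1 : ∑ x, p x = 1) :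
    ∑ s, roundLaw p E s * roundScore p α β γ E e s.1 s.2
      = ∑ x, α x + ∑ x, β x * E x + ∑ x, γ x * e x - entropy p E := by
  simp only [roundScore, mul_add, Finset.sum_add_distrib]
  rw [sum_roundLaw_mul_xi hp, sum_roundLaw_mul_logb, ← Finset.sum_mul, sum_roundLaw hp1]
  ring

/-- The variance is at most the second moment about any other point. -/
lemma sum_mul_sq_sub_mean_le {S : Type*} [Fintype S] {P Y : S → ℝ} (hP1 : ∑ s, P s = 1) {d : ℝ}
    (hd : ∑ s, P s * Y s = -d) (c : ℝ) :
    ∑ s, P s * (Y s + d) ^ 2 ≤ ∑ s, P s * (Y s + c) ^ 2 := by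
  have h : ∀ c : ℝ, ∑ s, P s * (Y s + c) ^ 2 = ∑ s, P s * Y s ^ 2 - 2 * c * d + c ^ 2 := by
    intro c
    calc _ = ∑ s, P s * Y s ^ 2 + 2 * c * ∑ s, P s * Y s + c ^ 2 * ∑ s, P s := by
          rw [Finset.mul_sum, Finset.mul_sum, ← Finset.sum_add_distrib, ← Finset.sum_add_distrib]
          refine Finset.sum_congr rfl fun s _ => ?_
          ring
      _ = _ := by rw [hd, hP1]; ring
  rw [h, h]
  nlinarith [sq_nonneg (c - d)]

lemma roundScore_le (hE : ∀ a x, 0 ≤ outProb E a x) (he0 : 0 ≤ e) (hγ : γ ≤ 0) (a : Bool)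
    (x : Fin 2) : roundScore p α β γ E e a x ≤ xiMax p α β := by
  have h1 := xi_le_xiMax p α β a x
  have h2 : Real.logb 2 (outProb E a x) ≤ 0 :=
    Real.logb_nonpos one_lt_two (hE a x) (outProb_le_one hE a x)
  have h3 : ∑ x, γ x * e x ≤ 0 := Finset.sum_nonpos fun x _ =>
    mul_nonpos_of_nonpos_of_nonneg (hγ x) (he0 x)
  unfold roundScore
  linarith

/-- The moment generating function of the score of one round. -/
lemma sum_roundLaw_mul_exp_le (hp : ∀ x, 0 < p x) (hp1 : ∑ x, p x = 1)
    (hE : ∀ a x, 0 ≤ outProb E a x) (he0 : 0 ≤ e) (he1 : e ≤ 1) (hγ : γ ≤ 0)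
    (hTF : ∑ x, α x + ∑ x, β x * E x + ∑ x, γ x * e x ≤ entropy p E)
    (hM : 0 < xiMax p α β) {r : ℝ} (hr : 0 ≤ r) (hr1 : r / 3 + r ^ 2 / 6 ≤ 1) :
    ∑ s, roundLaw p E s * Real.exp (r / (√(varBound p α β γ) + xiMax p α β * r / 3)
        * roundScore p α β γ E e s.1 s.2)
      ≤ Real.exp (r ^ 2 * √(varBound p α β γ)
        / (2 * (√(varBound p α β γ) + xiMax p α β * r / 3))) := by
  have hγe : ∑ x, γ x ≤ ∑ x, γ x * e x := Finset.sum_le_sum fun x _ => by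
    nlinarith [show γ x ≤ 0 from hγ x, show e x ≤ 1 from he1 x]
  have hmean : ∑ s, roundLaw p E s * roundScore p α β γ E e s.1 s.2
      = -(entropy p E - (∑ x, α x + ∑ x, β x * E x + ∑ x, γ x * e x)) := by
    rw [sum_roundLaw_mul_roundScore hp hp1]; ring
  have hdv : entropy p E - (∑ x, α x + ∑ x, β x * E x + ∑ x, γ x * e x)
      ≤ √(varBound p α β γ) := by
    have h1 := neg_xiMin_le_sqrt_varBound (p := p) (α := α) (β := β) (γ := γ)
    have h2 := xiMin_le_mean (α := α) (β := β) hp hp1 hE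
    have h3 := entropy_le_one (E := E) hp hp1
    linarith
  have hV : ∑ s, roundLaw p E s * (roundScore p α β γ E e s.1 s.2
      + (entropy p E - (∑ x, α x + ∑ x, β x * E x + ∑ x, γ x * e x))) ^ 2
        ≤ √(varBound p α β γ) ^ 2 := by
    rw [Real.sq_sqrt varBound_pos.le]
    -- Shifting by γ̄ − γ·e instead of by the mean removes the round's energies from the second
    -- moment.
    refine (sum_mul_sq_sub_mean_le (sum_roundLaw hp1) hmean
      (∑ x, γ x - ∑ x, γ x * e x)).trans (le_trans (le_of_eq ?_)
        (sum_roundLaw_mul_sq_le hp hp1 hE))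
    refine Finset.sum_congr rfl fun s _ => ?_
    unfold roundScore
    ring
  exact sum_mul_exp_le_of_mean (roundLaw p E) (fun s => roundScore p α β γ E e s.1 s.2)
    (roundLaw_nonneg hp hE) (sum_roundLaw hp1) hmean (sub_nonneg.2 hTF) hdv
    (Real.sqrt_pos.2 varBound_pos) hV hM (fun s => roundScore_le hE he0 hγ _ _) hr hr1

/-- The trade-off inequality for the vacuum forces the estimator to take a nonpositive value. -/
lemma xiMin_nonpos {ωpk : Fin 2 → ℝ} (hp : ∀ x, 0 < p x) (hp1 : ∑ x, p x = 1) (hpk : 0 ≤ ωpk)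
    (hTF : IsTradeoffFunction p ωpk α β γ) : xiMin p α β ≤ 0 := by
  have h1 := hTF.2 _ (vacuum_mem_quantumSetPeak hpk true)
  have hent : entropy p (fun _ => sgn true) = 0 := by
    simp [entropy, outProb, sgn]
  have hE : ∀ a x, 0 ≤ outProb (fun _ => sgn true) a x := by
    intro a x
    cases a <;> simp [outProb, sgn]
  simp only [hent, Pi.zero_apply, mul_zero, Finset.sum_const_zero, add_zero] at h1
  exact (xiMin_le_mean hp hp1 hE).trans h1

end Round

/-! ### Concentration over the rounds -/

section Concentration

variable {Ω L : Type*} [MeasurableSpace Ω] [MeasurableSpace L]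
  {μ : Measure Ω} [IsProbabilityMeasure μ] {n : ℕ} {A : Fin n → Ω → Bool}
  {X : Fin n → Ω → Fin 2} {Λ : Ω → L}
  {E en : (i : Fin n) → (Fin i.val → Bool × Fin 2) → L → Fin 2 → ℝ}
  {p ωpk ωavg α β γ : Fin 2 → ℝ} {εω : ℝ}

namespace NRoundModel

lemma peak_nonneg (h : NRoundModel μ A X Λ E en p ωpk ωavg εω) (hn : 0 < n) : 0 ≤ ωpk := by
  obtain ⟨ω, h1, h2⟩ := ((h.quantum ⟨0, hn⟩).and (h.peak ⟨0, hn⟩)).exists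
  exact (energy_nonneg_of_mem_quantumSet h1).trans h2

lemma measurable_roundScore (h : NRoundModel μ A X Λ E en p ωpk ωavg εω) (i : Fin n) (a : Bool)
    (x : Fin 2) (w : Fin i.val → Bool × Fin 2) :
    Measurable fun l => roundScore p α β γ (E i w l) (en i w l) a x := by
  have h1 : ∀ y, Measurable fun l => en i w l y := fun y =>
    (measurable_pi_apply y).comp (h.measurable_en i w)
  have h2 := measurable_outProb h.measurable_E i w a x
  unfold roundScore
  exact (measurable_const.add (Finset.measurable_sum _ fun y _ => (h1 y).const_mul _)).add
    ((Real.measurable_log.comp h2).div_const _)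

/-- The Chernoff bound for the total score. -/
lemma measureReal_score_le (h : NRoundModel μ A X Λ E en p ωpk ωavg εω)
    (hp : ∀ x, 0 < p x) (hp1 : ∑ x, p x = 1) (hpk : ωpk ≤ 1)
    (hTF : IsTradeoffFunction p ωpk α β γ) (hM : 0 < xiMax p α β) {r : ℝ} (hr : 0 ≤ r)
    (hr1 : r / 3 + r ^ 2 / 6 ≤ 1) :
    μ.real {ω | n * (√(varBound p α β γ) * r + xiMax p α β / 3 * (r ^ 2 / 2))
        < ∑ i, roundScore p α β γ (E i (past A X i ω) (Λ ω)) (en i (past A X i ω) (Λ ω))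
          (A i ω) (X i ω)} ≤ Real.exp (-(n * (r ^ 2 / 2))) := by
  have hv : 0 < √(varBound p α β γ) := Real.sqrt_pos.2 varBound_pos
  set v := √(varBound p α β γ) with hv_def
  set b := xiMax p α β with hb_def
  have hc0 : 0 ≤ r / (v + b * r / 3) := by positivity
  have hexp := chernoff_exponent hM hv hr
  set c := r / (v + b * r / 3) with hc_def
  set ψ := r ^ 2 * v / (2 * (v + b * r / 3)) with hψ_def
  let g : (i : Fin n) → Bool → Fin 2 → (Fin i.val → Bool × Fin 2) → L → ℝ≥0∞ := fun i a x w l =>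
    ENNReal.ofReal (Real.exp (c * roundScore p α β γ (E i w l) (en i w l) a x - ψ))
  have hg : ∀ i a x w, Measurable (g i a x w) := fun i a x w =>
    (Real.measurable_exp.comp
      (((h.measurable_roundScore i a x w).const_mul c).sub_const ψ)).ennreal_ofReal
  have hg1 : ∀ i, ∀ᵐ ω ∂μ, ∑ x, ENNReal.ofReal (p x) * ∑ a,
      ENNReal.ofReal (outProb (E i (past A X i ω) (Λ ω)) a x)
        * g i a x (past A X i ω) (Λ ω) ≤ 1 := by
    intro i
    filter_upwards [h.quantum i, h.peak i, h.ae_outProb_nonneg hp i] with ω hq hpeak hE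
    have key := sum_roundLaw_mul_exp_le hp hp1 hE (energy_nonneg_of_mem_quantumSet hq)
      (hpeak.trans hpk) hTF.1 (hTF.2 _ ⟨hq, hpeak⟩) hM hr hr1
    rw [sum_roundLaw_mul (fun s => Real.exp (r / (√(varBound p α β γ) + xiMax p α β * r / 3)
      * roundScore p α β γ (E i (past A X i ω) (Λ ω)) (en i (past A X i ω) (Λ ω)) s.1 s.2))] at key
    rw [← hv_def, ← hb_def, ← hc_def, ← hψ_def] at key
    have hsum : ∀ x, ENNReal.ofReal (p x) * ∑ a,
        ENNReal.ofReal (outProb (E i (past A X i ω) (Λ ω)) a x) * g i a x (past A X i ω) (Λ ω)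
          = ENNReal.ofReal (p x * ∑ a, outProb (E i (past A X i ω) (Λ ω)) a x
            * Real.exp (c * roundScore p α β γ (E i (past A X i ω) (Λ ω))
              (en i (past A X i ω) (Λ ω)) a x - ψ)) := by
      intro x
      rw [ENNReal.ofReal_mul (hp x).le, ENNReal.ofReal_sum_of_nonneg fun a _ =>
        mul_nonneg (hE a x) (Real.exp_pos _).le]
      congr 1
      exact Finset.sum_congr rfl fun a _ => (ENNReal.ofReal_mul (hE a x)).symm
    rw [Finset.sum_congr rfl fun x _ => hsum x, ← ENNReal.ofReal_sum_of_nonneg fun x _ =>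
      mul_nonneg (hp x).le (Finset.sum_nonneg fun a _ => mul_nonneg (hE a x) (Real.exp_pos _).le),
      ENNReal.ofReal_le_one]
    simp only [Real.exp_sub, ← mul_div_assoc, ← Finset.sum_div]
    exact (div_le_one (Real.exp_pos _)).2 key
  have hint := h.lintegral_prod_le_one g hg hg1
  have hmeas : Measurable fun ω => ∏ i, g i (A i ω) (X i ω) (past A X i ω) (Λ ω) :=
    Finset.measurable_prod _ fun i _ => h.measurable_round i (g i) (hg i)
  have hmarkov := meas_ge_le_lintegral_div (μ := μ) hmeas.aemeasurable
    (ε := ENNReal.ofReal (Real.exp (n * (r ^ 2 / 2))))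
    (ENNReal.ofReal_pos.2 (Real.exp_pos _)).ne' ENNReal.ofReal_ne_top
  have hsub : {ω | n * (v * r + b / 3 * (r ^ 2 / 2))
        < ∑ i, roundScore p α β γ (E i (past A X i ω) (Λ ω)) (en i (past A X i ω) (Λ ω))
          (A i ω) (X i ω)}
      ⊆ {ω | ENNReal.ofReal (Real.exp (n * (r ^ 2 / 2)))
        ≤ ∏ i, g i (A i ω) (X i ω) (past A X i ω) (Λ ω)} := by
    intro ω hω
    simp only [Set.mem_ofPred_eq] at hω ⊢
    simp only [g]
    rw [← ENNReal.ofReal_prod_of_nonneg fun i _ => (Real.exp_pos _).le, ← Real.exp_sum]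
    refine ENNReal.ofReal_le_ofReal (Real.exp_le_exp.2 ?_)
    -- By `hexp`, r²/2 equals c times the per-round threshold minus ψ.
    rw [Finset.sum_sub_distrib, ← Finset.mul_sum, Finset.sum_const, Finset.card_univ,
      Fintype.card_fin, nsmul_eq_mul, ← hexp]
    nlinarith [mul_le_mul_of_nonneg_left hω.le hc0]
  rw [measureReal_def]
  refine ENNReal.toReal_le_of_le_ofReal (Real.exp_pos _).le ?_
  refine (measure_mono hsub).trans (hmarkov.trans ?_)
  rw [Real.exp_neg, ENNReal.ofReal_inv_of_pos (Real.exp_pos _), ← one_div]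
  gcongr

/-- With probability at least `1 - εt` the total score is at most `n` times the error term. -/
lemma measureReal_score_gt_errorTerm_le (h : NRoundModel μ A X Λ E en p ωpk ωavg εω) (hn : 0 < n)
    (hp : ∀ x, 0 < p x) (hp1 : ∑ x, p x = 1) (hpk : ωpk ≤ 1)
    (hTF : IsTradeoffFunction p ωpk α β γ) {εt : ℝ} (hεt : 0 < εt) (hεt1 : εt < 1)
    (ht : 0 ≤ errorTerm n p α β γ εt) :
    μ.real {ω | n * errorTerm n p α β γ εt
        < ∑ i, roundScore p α β γ (E i (past A X i ω) (Λ ω)) (en i (past A X i ω) (Λ ω))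
          (A i ω) (X i ω)} ≤ εt := by
  have hn' : (0 : ℝ) < n := Nat.cast_pos.2 hn
  by_cases hbt : xiMax p α β ≤ errorTerm n p α β γ εt
  · have h0 : ∀ᵐ ω ∂μ, ¬ n * errorTerm n p α β γ εt
        < ∑ i, roundScore p α β γ (E i (past A X i ω) (Λ ω)) (en i (past A X i ω) (Λ ω))
          (A i ω) (X i ω) := by
      filter_upwards [ae_all_iff.2 h.quantum, ae_all_iff.2 (h.ae_outProb_nonneg hp)]
        with ω hq hE
      rw [not_lt]
      calc _ ≤ ∑ _i : Fin n, xiMax p α β := Finset.sum_le_sum fun i _ =>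
            roundScore_le (hE i) (energy_nonneg_of_mem_quantumSet (hq i)) hTF.1 _ _
        _ = n * xiMax p α β := by simp
        _ ≤ _ := by gcongr
    refine le_of_eq_of_le ?_ hεt.le
    rw [measureReal_def, (measure_eq_zero_iff_ae_notMem (μ := μ)).2 (by simpa using h0),
      ENNReal.toReal_zero]
  rw [not_le] at hbt
  have hM : 0 < xiMax p α β := ht.trans_lt hbt
  have hm := xiMin_nonpos hp hp1 (h.peak_nonneg hn) hTF
  have hbv := xiMax_le_two_mul_sqrt_varBound (γ := γ) hm hM.le
  have hlog : 0 < Real.log (1 / εt) := Real.log_pos ((one_lt_div hεt).2 hεt1)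
  have hlog2 : 0 < Real.log 2 := Real.log_pos one_lt_two
  -- The Chernoff bound is a natural exponential, while t uses base two; as log 2 < 1, the change of
  -- base only helps.
  have hlogb : Real.log (1 / εt) ≤ Real.logb 2 (1 / εt) := by
    rw [Real.logb, le_div_iff₀ hlog2]
    nlinarith [Real.log_two_lt_d9]
  have hu : 0 ≤ Real.logb 2 (1 / εt) / n := div_nonneg (hlog.le.trans hlogb) hn'.le
  set r := √(2 * (Real.logb 2 (1 / εt) / n)) with hr_def
  have hr0 : 0 ≤ r := Real.sqrt_nonneg _
  have hr2 : r ^ 2 / 2 = Real.logb 2 (1 / εt) / n := by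
    rw [hr_def, Real.sq_sqrt (by positivity)]
    ring
  have ht_eq : errorTerm n p α β γ εt
      = √(varBound p α β γ) * r + xiMax p α β / 3 * (r ^ 2 / 2) := by
    rw [errorTerm, hr2, hr_def, Real.sqrt_mul zero_le_two, Real.sqrt_mul zero_le_two]
    ring
  rw [ht_eq] at hbt ⊢
  -- Insert √V ≥ ξ⁺/2 into t < ξ⁺ and divide by ξ⁺.
  have hr1 : r / 2 + r ^ 2 / 6 < 1 := by
    by_contra hcon
    rw [not_lt] at hcon
    nlinarith [mul_le_mul_of_nonneg_right hbv hr0, mul_le_mul_of_nonneg_left hcon hM.le]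
  refine (h.measureReal_score_le hp hp1 hpk hTF hM hr0 (by linarith)).trans ?_
  rw [hr2, mul_div_cancel₀ _ hn'.ne']
  calc Real.exp (-Real.logb 2 (1 / εt)) ≤ Real.exp (-Real.log (1 / εt)) := by gcongr
    _ = εt := by rw [one_div, Real.log_inv, neg_neg, Real.exp_log hεt]

end NRoundModel

end Concentration

end SemiDI

/-! ### From the score bound to the entropy estimate -/

theorem theorem4 {Ω L : Type*} [MeasurableSpace Ω] [MeasurableSpace L]
    (μ : Measure Ω) [IsProbabilityMeasure μ] {n : ℕ} (hn : 0 < n)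
    (A : Fin n → Ω → Bool) (X : Fin n → Ω → Fin 2) (Λ : Ω → L)
    (E en : (i : Fin n) → (Fin i.val → Bool × Fin 2) → L → Fin 2 → ℝ)
    (p ωpk ωavg : Fin 2 → ℝ) (hp : ∀ x, 0 < p x) (hp1 : ∑ x, p x = 1) (hpk : ωpk ≤ 1)
    (εω εt : ℝ) (hεω : 0 ≤ εω) (hεt : 0 < εt)
    (hmodel : SemiDI.NRoundModel μ A X Λ E en p ωpk ωavg εω)
    (α β γ : Fin 2 → ℝ) (hTF : SemiDI.IsTradeoffFunction p ωpk α β γ)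
    (ht : 0 ≤ SemiDI.errorTerm n p α β γ εt) :
    1 - εω - εt ≤ μ.real {ω |
      -(1 / (n : ℝ)) * Real.logb 2
          (SemiDI.condProb μ (fun ω i => A i ω) (fun ω => ((fun i => X i ω), Λ ω))
            (fun i => A i ω) ω)
        ≥ (1 / (n : ℝ)) * ∑ i, SemiDI.xi p α β (A i ω) (X i ω)
          + ∑ x, γ x * ωavg x - SemiDI.errorTerm n p α β γ εt} := by

  have hn' : (0 : ℝ) < n := Nat.cast_pos.2 hn
  rcases le_or_gt 1 εt with hεt1 | hεt1
  · exact le_trans (by linarith) measureReal_nonneg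
  have hbad := hmodel.measureReal_score_gt_errorTerm_le hn hp hp1 hpk hTF hεt hεt1 ht
  set t := SemiDI.errorTerm n p α β γ εt
  set bad := {ω | n * t < ∑ i, SemiDI.roundScore p α β γ (E i (SemiDI.past A X i ω) (Λ ω))
    (en i (SemiDI.past A X i ω) (Λ ω)) (A i ω) (X i ω)} with hbad_def
  set avg := {ω | ∀ x, (1 / (n : ℝ)) * ∑ i, en i (SemiDI.past A X i ω) (Λ ω) x ≤ ωavg x}
    with havg_def
  have havg : 1 - εω ≤ μ.real avg := hmodel.average
  set good := {ω | -(1 / (n : ℝ)) * Real.logb 2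
          (SemiDI.condProb μ (fun ω i => A i ω) (fun ω => ((fun i => X i ω), Λ ω))
            (fun i => A i ω) ω)
        ≥ (1 / (n : ℝ)) * ∑ i, SemiDI.xi p α β (A i ω) (X i ω)
          + ∑ x, γ x * ωavg x - t} with hgood_def
  have hsub : ∀ᵐ ω ∂μ, ω ∈ avg → ω ∈ good ∪ bad := by
    -- Positivity of the probabilities that occur is what lets the logarithm of the product split
    -- into a sum.
    filter_upwards [hmodel.ae_condProb_eq hp, ae_all_iff.2 hmodel.ae_outProb_pos]
      with ω hcond hpos hω
    by_cases hb : ω ∈ bad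
    · exact Or.inr hb
    left
    rw [hbad_def, Set.mem_ofPred_eq, not_lt] at hb
    rw [hgood_def, Set.mem_ofPred_eq, hcond, Real.logb_prod _ _ fun i _ => (hpos i).ne', ge_iff_le]
    have hγ : ∑ x, γ x * ωavg x
        ≤ (1 / (n : ℝ)) * ∑ i, ∑ x, γ x * en i (SemiDI.past A X i ω) (Λ ω) x := by
      rw [Finset.sum_comm, Finset.mul_sum]
      refine Finset.sum_le_sum fun x _ => ?_
      rw [← Finset.mul_sum, mul_left_comm]
      exact mul_le_mul_of_nonpos_left (hω x) (hTF.1 x)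
    simp only [SemiDI.roundScore, Finset.sum_add_distrib] at hb
    have hb' := mul_le_mul_of_nonneg_left hb (one_div_nonneg.2 hn'.le)
    rw [← mul_assoc, one_div_mul_cancel hn'.ne', one_mul, mul_add, mul_add] at hb'
    linarith
  have hle : μ.real avg ≤ μ.real good + μ.real bad := by
    refine le_trans ?_ (measureReal_union_le good bad)
    exact ENNReal.toReal_mono (measure_ne_top _ _) (measure_mono_ae hsub)
  linarith
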